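/- There is a universal constant $c>0$ such that the following holds. Let $X$ be a measurable space, let $k,n\ge 1$ be integers, and let $H$ be a class of subsets of $X$ (concepts) of finite VC-dimension $V$, i.e. $V$ is the largest size of a finite set $s\subseteq X$ all of whose subsets are of the form $s\cap h$ with $h\in H$. Let $D$ be any probability distribution on $X\times\{1,\dots,k\}$, and let $S=((x_1,y_1),\dots,(x_n,y_n))$ be an i.i.d. sample from $D$. For $h\subseteq X$ and $1\le i\le k$, consider $h$ as a binary (in-class/out-class) classifier for class $i$, which errs on $(x,y)$ when exactly one of $x\in h$ and $y=i$ holds; let $\operatorname{err}_i(h)$ be the $D$-probability that it errs and let $\widehat{\operatorname{err}}_i(h)$ be the fraction of the $n$ sample points on which it errs. For each $i$ let $h_i\in H$ be a classifier trained for class $i$ on $S$ by an arbitrary learning algorithm, which may also use randomness $r$ independent of $S$; that is, $h_i=A_i(r,S)\in H$, where the only assumption on $A_i$ is that $\{((r,S),x) : x\in A_i(r,S)\}$ is a measurable set. Then for every $\delta\in(0,1)$, with probability at least $1-\delta$ over $S$ and $r$, $$\max_{1\le i\le k}\bigl(\operatorname{err}_i(h_i)-\widehat{\operatorname{err}}_i(h_i)\bigr)\le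 c\sqrt{\frac{V+\log(k/\delta)}{n}} .$$ -/

import Mathlib

open MeasureTheory

namespace OneVsAll

/-- The concept class `H` shatters the finite set `s`: every subset of `s` is cut out of `s` by
some concept of `H`. -/
def Shatters {X : Type*} (H : Set (Set X)) (s : Finset X) : Prop :=
  ∀ t : Finset X, t ⊆ s → ∃ h ∈ H, (s : Set X) ∩ h = (t : Set X)

/-- The VC-dimension of `H`: the supremum of the sizes of the finite sets shattered by `H`
(possibly `⊤`). -/
noncomputable def vcDim {X : Type*} (H : Set (Set X)) : ℕ∞ :=
  ⨆ (s : Finset X) (_ : Shatters H s), (s.card : ℕ∞)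

/-- The labelled points `(x, y)` on which the concept `h`, used as the in-class/out-class classifier
of class `i`, errs: `x ∈ h` although `y ≠ i`, or `x ∉ h` although `y = i`. -/
def errorSet {X : Type*} {k : ℕ} (i : Fin k) (h : Set X) : Set (X × Fin k) :=
  {z | ¬ (z.1 ∈ h ↔ z.2 = i)}

/-- The generalization error of `h` as binary classifier of class `i`, under the distribution `D`
of labelled points. -/
noncomputable def err {X : Type*} [MeasurableSpace X] {k : ℕ} (D : Measure (X × Fin k))
    (i : Fin k) (h : Set X) : ℝ :=
  D.real (errorSet i h)

/-- The sample error of `h` as binary classifier of class `i`: the fraction of the points of the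
sample `S` on which it errs. -/
noncomputable def sampleErr {X : Type*} {k n : ℕ} (S : Fin n → X × Fin k)
    (i : Fin k) (h : Set X) : ℝ :=
  ({j : Fin n | S j ∈ errorSet i h}.ncard : ℝ) / n

end OneVsAll

/-! The trained concept depends on the sample, so its deviation is controlled uniformly over `H`. A
ghost sample replaces the true error by a second empirical frequency
(`measure_deviation_le_two_mul`). The law of the resulting pairs is invariant under exchanges within
pairs, so it suffices to count, for each fixed double sample, the sign patterns that give some error
set a large signed sum (`measure_le_of_card_swapPairs_le`). For a fixed class, error sets are
concepts xored with a fixed labelling, so their traces have VC-dimension at most `V`.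

A plain union bound over all traces would cost an extra `log n`; chaining avoids it. By Dudley's
packing bound (`log_card_le_of_separated`), a `2n / 4^l`-separated family of traces has
log-cardinality of order `V (l + 1)`, while a link at scale `l` is a sub-Gaussian sum with variance
proxy of order `n / 4^l`. Thresholds proportional to `√(n (V + τ)) (l + 1) / 2^l` therefore suffice,
and they are summable (`card_exists_signedSum_gt_le`). A union bound over the `k` classes produces
`log (k / δ)`. -/

namespace OneVsAll

open Finset Real
open scoped symmDiff

/-! ### Sauer-Shelah and packing numbers -/

/-- A form of the Sauer-Shelah bound convenient for taking logarithms. -/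
lemma card_mul_pow_le_exp {α : Type*} [Fintype α] [DecidableEq α] (𝒜 : Finset (Finset α)) {V : ℕ}
    (hV : 𝒜.vcDim ≤ V) {x : ℝ} (hx0 : 0 ≤ x) (hx1 : x ≤ 1) :
    (#𝒜 : ℝ) * x ^ V ≤ exp (x * Fintype.card α) := by
  calc (#𝒜 : ℝ) * x ^ V ≤ (#𝒜.shatterer : ℝ) * x ^ V := by
        exact mul_le_mul_of_nonneg_right (by exact_mod_cast card_le_card_shatterer 𝒜) (by positivity)
    _ = ∑ s ∈ 𝒜.shatterer, x ^ V := by simp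
    -- Shattered sets have at most `V` elements and `x ≤ 1`; extending the sum to all subsets then
    -- makes it binomial.
    _ ≤ ∑ s ∈ 𝒜.shatterer, x ^ #s := sum_le_sum fun s hs ↦
        pow_le_pow_of_le_one hx0 hx1 ((mem_shatterer.1 hs).card_le_vcDim.trans hV)
    _ ≤ ∑ s ∈ (univ : Finset α).powerset, x ^ #s :=
        sum_le_sum_of_subset_of_nonneg (fun s _ ↦ by simp) fun _ _ _ ↦ by positivity
    _ = (x + 1) ^ Fintype.card α := by
        have := sum_pow_mul_eq_add_pow x 1 (univ : Finset α)
        simpa using this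
    _ ≤ exp x ^ Fintype.card α := by gcongr; exact add_one_le_exp x
    _ = exp (x * Fintype.card α) := by rw [← exp_nat_mul, mul_comm]

/-- If the traces on an index set of the concepts of `H`, or of the errors of these concepts with
respect to a fixed labelling, shatter `s`, then `H` shatters a set of the same size. -/
lemma exists_shatters_of_trace {κ X : Type*} [DecidableEq κ] {𝒜 : Finset (Finset κ)}
    {H : Set (Set X)} (x : κ → X) (T : κ → Prop)
    (h𝒜 : ∀ B ∈ 𝒜, ∃ h ∈ H, ∀ j, j ∈ B ↔ ¬ (x j ∈ h ↔ T j)) {s : Finset κ}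
    (hs : 𝒜.Shatters s) : ∃ s' : Finset X, Shatters H s' ∧ #s' = #s := by
  classical
  have key : ∀ P : κ → Prop, ∃ h ∈ H, ∀ j ∈ s, (x j ∈ h ↔ P j) := by
    intro P
    -- Prescribing the disagreement of `P` with `T` as the trace cancels the labelling.
    obtain ⟨B, hB, hsB⟩ := hs (t := s.filter fun j ↦ ¬ (P j ↔ T j)) (filter_subset _ _)
    obtain ⟨h, hh, hBh⟩ := h𝒜 B hB
    refine ⟨h, hh, fun j hj ↦ ?_⟩
    have h1 : j ∈ s ∩ B ↔ j ∈ s.filter fun j ↦ ¬ (P j ↔ T j) := by rw [hsB]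
    simp only [mem_inter, hj, true_and, mem_filter, hBh j] at h1
    tauto
  have hinj : Set.InjOn x s := by
    intro j hj j' hj' hjj
    by_contra hne
    obtain ⟨h, -, hP⟩ := key (fun i ↦ i = j)
    have h1 := (hP j hj).2 rfl
    rw [hjj] at h1
    exact hne ((hP j' hj').1 h1).symm
  refine ⟨s.image x, fun t ht ↦ ?_, card_image_of_injOn hinj⟩
  obtain ⟨h, hh, hP⟩ := key (fun j ↦ x j ∈ t)
  refine ⟨h, hh, ?_⟩
  ext a
  simp only [Set.mem_inter_iff, mem_coe, mem_image]
  constructor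
  · rintro ⟨⟨j, hj, rfl⟩, ha⟩
    exact (hP j hj).1 ha
  · intro ha
    obtain ⟨j, hj, rfl⟩ := mem_image.1 (ht ha)
    exact ⟨⟨j, hj, rfl⟩, (hP j hj).2 ha⟩

/-- Indices shattered by the pullback hit distinct points, which the original family shatters. This
lets Sauer-Shelah be applied on a few drawn points instead of the whole ground set. -/
lemma vcDim_image_preimage_le {κ ι : Type*} [Fintype κ] [DecidableEq κ] [DecidableEq ι]
    (𝒢 : Finset (Finset ι)) (f : κ → ι) :
    (𝒢.image fun B ↦ univ.filter fun j ↦ f j ∈ B).vcDim ≤ 𝒢.vcDim := by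
  refine Finset.sup_le fun s hs ↦ ?_
  rw [mem_shatterer] at hs
  obtain ⟨s', hs', hcard⟩ := exists_shatters_of_trace (H := {h | ∃ B ∈ 𝒢, h = (B : Set ι)}) f
    (fun _ ↦ False) (by
      intro B hB
      obtain ⟨G, hG, rfl⟩ := mem_image.1 hB
      exact ⟨G, ⟨G, hG, rfl⟩, fun j ↦ by simp⟩) hs
  rw [← hcard]
  refine Shatters.card_le_vcDim fun t ht ↦ ?_
  obtain ⟨h, ⟨B, hB, rfl⟩, hh⟩ := hs' t ht
  exact ⟨B, hB, by exact_mod_cast hh⟩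

/-- If more than `2 log #𝒢 / ε` points are drawn, some draw distinguishes all members of an
`ε`-separated family. -/
lemma exists_separating_points {ι : Type*} [Fintype ι] [DecidableEq ι] [Nonempty ι]
    {𝒢 : Finset (Finset ι)} {ε : ℝ}
    (hsep : ∀ B ∈ 𝒢, ∀ B' ∈ 𝒢, B ≠ B' → ε * Fintype.card ι ≤ #(B ∆ B'))
    {m : ℕ} (hm : (#𝒢 : ℝ) ^ 2 * exp (-(ε * m)) < 1) :
    ∃ f : Fin m → ι, Set.InjOn (fun B : Finset ι ↦ univ.filter fun j ↦ f j ∈ B) 𝒢 := by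
  classical
  by_contra! hcon
  set N : ℝ := ((Fintype.card ι : ℕ) : ℝ) with hN
  have hNpos : 0 < N := by rw [hN]; exact_mod_cast Fintype.card_pos
  set pairs := (𝒢 ×ˢ 𝒢).filter fun p ↦ p.1 ≠ p.2
  -- A draw that fails to separate a pair misses its symmetric difference at every coordinate.
  have hcover : (univ : Finset (Fin m → ι)) ⊆
      pairs.biUnion fun p ↦ Fintype.piFinset fun _ ↦ (p.1 ∆ p.2)ᶜ := by
    intro f _
    have := hcon f
    simp only [Set.InjOn, not_forall] at this
    obtain ⟨B, hB, B', hB', heq, hne⟩ := this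
    refine mem_biUnion.2 ⟨(B, B'), by simp_all [pairs], ?_⟩
    rw [Fintype.mem_piFinset]
    intro j
    have : j ∈ (univ.filter fun j ↦ f j ∈ B) ↔ j ∈ (univ.filter fun j ↦ f j ∈ B') := by
      rw [heq]
    simp only [mem_filter, mem_univ, true_and] at this
    simp only [mem_compl, mem_symmDiff]
    tauto
  have h1 := (card_le_card hcover).trans card_biUnion_le
  have h2 : ∀ p ∈ pairs, ((#(Fintype.piFinset fun _ : Fin m ↦ (p.1 ∆ p.2)ᶜ) : ℕ) : ℝ) ≤
      N ^ m * exp (-(ε * m)) := by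
    intro p hp
    simp only [pairs, mem_filter, mem_product] at hp
    have hs := hsep _ hp.1.1 _ hp.1.2 hp.2
    rw [Fintype.card_piFinset_const, Nat.cast_pow, card_compl, Nat.cast_sub (card_le_univ _)]
    have h3 : N - #(p.1 ∆ p.2) ≤ N * exp (-ε) := by
      have := add_one_le_exp (-ε)
      nlinarith
    have h4 : 0 ≤ N - #(p.1 ∆ p.2) := by
      rw [sub_nonneg, hN]; exact_mod_cast card_le_univ _
    calc (N - #(p.1 ∆ p.2)) ^ m ≤ (N * exp (-ε)) ^ m := by gcongr
      _ = N ^ m * exp (-(ε * m)) := by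
        rw [mul_pow, ← exp_nat_mul]; congr 2; ring
  have h5 : (N ^ m : ℝ) ≤ ∑ p ∈ pairs, N ^ m * exp (-(ε * m)) := by
    calc (N ^ m : ℝ) = ((#(univ : Finset (Fin m → ι)) : ℕ) : ℝ) := by simp [hN]
      _ ≤ ((∑ p ∈ pairs, #(Fintype.piFinset fun _ : Fin m ↦ (p.1 ∆ p.2)ᶜ) : ℕ) : ℝ) :=
        Nat.cast_le.2 h1
      _ ≤ _ := by rw [Nat.cast_sum]; exact sum_le_sum h2
  have h6 : (#pairs : ℝ) ≤ (#𝒢 : ℝ) ^ 2 := by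
    have : #pairs ≤ #𝒢 * #𝒢 := (card_filter_le _ _).trans (card_product _ _).le
    rw [sq]; exact_mod_cast this
  rw [sum_const, nsmul_eq_mul] at h5
  have hP : 0 < N ^ m := by positivity
  have h7 : (#pairs : ℝ) * exp (-(ε * m)) < 1 :=
    lt_of_le_of_lt (mul_le_mul_of_nonneg_right h6 (exp_pos _).le) hm
  nlinarith

/-- **Dudley's packing bound** for families of finite VC-dimension. -/
lemma log_card_le_of_separated {ι : Type*} [Fintype ι] [DecidableEq ι] [Nonempty ι]
    {𝒢 : Finset (Finset ι)} (hne : 𝒢.Nonempty) {V : ℕ} (hV : 𝒢.vcDim ≤ V) {ε : ℝ} (hε0 : 0 < ε)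
    (hε1 : ε ≤ 1) (hsep : ∀ B ∈ 𝒢, ∀ B' ∈ 𝒢, B ≠ B' → ε * Fintype.card ι ≤ #(B ∆ B')) :
    log #𝒢 ≤ 4 / 3 * (V * log (8 / ε) + 1 / 4) := by
  classical
  have hM : (0 : ℝ) < #𝒢 := by exact_mod_cast hne.card_pos
  have hM1 : (1 : ℝ) ≤ #𝒢 := by exact_mod_cast hne.card_pos
  set L := log #𝒢 with hL
  have hL0 : 0 ≤ L := log_nonneg hM1
  set m := ⌊2 * L / ε⌋₊ + 1 with hm
  have hm1 : 2 * L / ε < m := by rw [hm]; push_cast; exact Nat.lt_floor_add_one _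
  have hm2 : (m : ℝ) ≤ 2 * L / ε + 1 := by
    rw [hm]; push_cast; gcongr; exact Nat.floor_le (by positivity)
  have hsm : (#𝒢 : ℝ) ^ 2 * exp (-(ε * m)) < 1 := by
    rw [← exp_log hM, ← hL, ← exp_nat_mul, ← exp_add, exp_lt_one_iff]
    rw [div_lt_iff₀ hε0] at hm1
    push_cast
    linarith
  obtain ⟨f, hf⟩ := exists_separating_points hsep hsm
  -- With `x = ε / 8` the exponent `x * m` is at most `L / 4 + 1 / 8`; absorbing `L / 4` on the left
  -- gives the factor `4 / 3`.
  have h1 := card_mul_pow_le_exp _ ((vcDim_image_preimage_le 𝒢 f).trans hV) (x := ε / 8)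
    (by positivity) (by linarith)
  rw [card_image_of_injOn hf, Fintype.card_fin] at h1
  have h2 := log_le_log (by positivity) h1
  rw [log_exp, log_mul hM.ne' (by positivity), log_pow, ← hL] at h2
  have h3 : log (8 / ε) = - log (ε / 8) := by rw [← log_inv, inv_div]
  have h4 : ε / 8 * m ≤ L / 4 + 1 / 8 := by
    calc ε / 8 * m ≤ ε / 8 * (2 * L / ε + 1) := by gcongr
      _ = L / 4 + ε / 8 := by field_simp; ring
      _ ≤ _ := by linarith
  rw [h3]
  linarith

/-- A maximal separated subfamily is a net. -/
lemma exists_separated_net {ι : Type*} [DecidableEq ι] (𝒜 : Finset (Finset ι)) (hne : 𝒜.Nonempty)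
    (a b : ℕ) :
    ∃ 𝒢 ⊆ 𝒜, 𝒢.Nonempty ∧ (∀ B ∈ 𝒢, ∀ B' ∈ 𝒢, B ≠ B' → a ≤ b * #(B ∆ B')) ∧
      ∀ B ∈ 𝒜, ∃ G ∈ 𝒢, b * #(B ∆ G) ≤ a := by
  classical
  set P := 𝒜.powerset.filter fun 𝒢 ↦ ∀ B ∈ 𝒢, ∀ B' ∈ 𝒢, B ≠ B' → a ≤ b * #(B ∆ B')
  obtain ⟨𝒢, h𝒢, hmax⟩ := P.exists_max_image card ⟨∅, by simp [P]⟩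
  simp only [P, mem_filter, mem_powerset] at h𝒢 hmax
  have hcov : ∀ B ∈ 𝒜, ∃ G ∈ 𝒢, b * #(B ∆ G) ≤ a := by
    intro B hB
    by_contra! hcon
    have hB𝒢 : B ∉ 𝒢 := fun h ↦ by simpa using hcon B h
    have := hmax (insert B 𝒢) ⟨insert_subset hB h𝒢.1, ?_⟩
    · rw [card_insert_of_notMem hB𝒢] at this; omega
    · intro C hC C' hC' hne
      rw [mem_insert] at hC hC'
      rcases hC with rfl | hC <;> rcases hC' with rfl | hC'
      · exact absurd rfl hne
      · exact (hcon _ hC').le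
      · rw [symmDiff_comm]; exact (hcon _ hC).le
      · exact h𝒢.2 _ hC _ hC' hne
  obtain ⟨B, hB⟩ := hne
  obtain ⟨G, hG, -⟩ := hcov B hB
  exact ⟨𝒢, h𝒢.1, ⟨G, hG⟩, h𝒢.2, hcov⟩

/-! ### Sub-Gaussian tails of random sign sums -/

/-- The real sign of a Boolean. -/
noncomputable def boolSign (b : Bool) : ℝ := if b then 1 else -1

lemma sum_exp_sign_le {n : ℕ} (a : Fin n → ℝ) (t : ℝ) :
    ∑ σ : Fin n → Bool, exp (t * ∑ j, boolSign (σ j) * a j) ≤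
      2 ^ n * exp (t ^ 2 / 2 * ∑ j, a j ^ 2) := by
  have h1 : ∑ σ : Fin n → Bool, exp (t * ∑ j, boolSign (σ j) * a j) =
      ∏ j, ∑ b : Bool, exp (t * (boolSign b * a j)) := by
    rw [prod_univ_sum, Fintype.piFinset_univ]
    refine sum_congr rfl fun σ _ ↦ ?_
    rw [mul_sum, exp_sum]
  have h2 : ∀ j, ∑ b : Bool, exp (t * (boolSign b * a j)) ≤ 2 * exp (t ^ 2 / 2 * a j ^ 2) := by
    intro j
    have := cosh_le_exp_half_sq (t * a j)
    rw [cosh_eq] at this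
    simp only [boolSign, Fintype.sum_bool]
    rw [show t ^ 2 / 2 * a j ^ 2 = (t * a j) ^ 2 / 2 by ring]
    simp only [if_true, Bool.false_eq_true, if_false, one_mul, neg_mul, mul_neg]
    linarith
  rw [h1]
  calc _ ≤ ∏ j, 2 * exp (t ^ 2 / 2 * a j ^ 2) :=
        prod_le_prod (fun _ _ ↦ sum_nonneg fun _ _ ↦ (exp_pos _).le) fun j _ ↦ h2 j
    _ = _ := by rw [prod_mul_distrib, mul_sum, exp_sum]; simp

lemma card_sign_tail_le {n : ℕ} (a : Fin n → ℝ) {d u : ℝ} (hd : 0 < d) (hu : 0 ≤ u)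
    (ha : ∑ j, a j ^ 2 ≤ 2 * d) :
    (#{σ : Fin n → Bool | u < ∑ j, boolSign (σ j) * a j} : ℝ) ≤ 2 ^ n * exp (-(u ^ 2 / (4 * d))) := by
  -- The minimizer of the Chernoff exponent `t ^ 2 * d - t * u`.
  set t := u / (2 * d) with ht
  have ht0 : 0 ≤ t := by positivity
  set A : Finset (Fin n → Bool) := {σ : Fin n → Bool | u < ∑ j, boolSign (σ j) * a j}
  have h1 : (#A : ℝ) * exp (t * u) ≤ 2 ^ n * exp (t ^ 2 * d) := by
    calc (#A : ℝ) * exp (t * u) = ∑ σ ∈ A, exp (t * u) := by simp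
      _ ≤ ∑ σ ∈ A, exp (t * ∑ j, boolSign (σ j) * a j) := by
        refine sum_le_sum fun σ hσ ↦ ?_
        have := (mem_filter.1 hσ).2
        gcongr
      _ ≤ ∑ σ : Fin n → Bool, exp (t * ∑ j, boolSign (σ j) * a j) :=
        sum_le_sum_of_subset_of_nonneg (subset_univ _) fun _ _ _ ↦ (exp_pos _).le
      _ ≤ 2 ^ n * exp (t ^ 2 / 2 * ∑ j, a j ^ 2) := sum_exp_sign_le a t
      _ ≤ 2 ^ n * exp (t ^ 2 / 2 * (2 * d)) := by gcongr
      _ = _ := by congr 2; ring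
  calc (#A : ℝ) = (#A : ℝ) * exp (t * u) * exp (-(t * u)) := by
        rw [mul_assoc, ← exp_add]; simp
    _ ≤ 2 ^ n * exp (t ^ 2 * d) * exp (-(t * u)) := by gcongr
    _ = _ := by
      rw [mul_assoc, ← exp_add]; congr 2
      rw [ht]; field_simp; ring

/-- The signed difference of the numbers of points of a set `B` in the two halves of a double
sample. -/
noncomputable def signedSum {n : ℕ} (σ : Fin n → Bool) (B : Finset (Fin n × Bool)) : ℝ :=
  ∑ j, boolSign (σ j) *
    ((if (j, true) ∈ B then 1 else 0) - (if (j, false) ∈ B then 1 else 0))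

lemma card_signedSum_sub_le {n : ℕ} (B B' : Finset (Fin n × Bool)) {d u : ℝ} (hd : 0 < d)
    (hu : 0 ≤ u) (hB : #(B ∆ B') ≤ d) :
    (#{σ : Fin n → Bool | u < signedSum σ B - signedSum σ B'} : ℝ) ≤
      2 ^ n * exp (-(u ^ 2 / (4 * d))) := by
  have hsum : ∀ σ : Fin n → Bool, signedSum σ B - signedSum σ B' = ∑ j, boolSign (σ j) *
      (((if (j, true) ∈ B then 1 else 0) - (if (j, false) ∈ B then 1 else 0)) -
       ((if (j, true) ∈ B' then 1 else 0) - (if (j, false) ∈ B' then 1 else 0))) := by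
    intro σ
    simp only [signedSum, ← sum_sub_distrib, ← mul_sub]
  simp only [hsum]
  refine card_sign_tail_le _ hd hu ?_
  have hcard : (#(B ∆ B') : ℝ) = ∑ j : Fin n, ((if (j, true) ∈ B ∆ B' then 1 else 0) +
      (if (j, false) ∈ B ∆ B' then 1 else 0)) := by
    have h : (#(B ∆ B') : ℝ) = ∑ p : Fin n × Bool, if p ∈ B ∆ B' then 1 else 0 := by simp
    rw [h, Fintype.sum_prod_type]
    simp only [Fintype.sum_bool]
  -- Each coefficient is a difference of two terms of modulus at most one, so its square is at most
  -- twice the number of members of pair `j` in `B ∆ B'`.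
  calc _ ≤ ∑ j : Fin n, 2 * (((if (j, true) ∈ B ∆ B' then 1 else 0) +
      (if (j, false) ∈ B ∆ B' then 1 else 0)) : ℝ) := by
        refine sum_le_sum fun j _ ↦ ?_
        simp only [mem_symmDiff]
        by_cases h1 : (j, true) ∈ B <;> by_cases h2 : (j, false) ∈ B <;>
          by_cases h3 : (j, true) ∈ B' <;> by_cases h4 : (j, false) ∈ B' <;>
          simp [h1, h2, h3, h4] <;> norm_num
    _ = 2 * #(B ∆ B') := by rw [hcard, mul_sum]
    _ ≤ _ := by gcongr

/-! ### Chaining -/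

/-- The threshold at scale `l` of the chaining argument. -/
noncomputable def chainStep (s : ℝ) (l : ℕ) : ℝ := 13 * s * ((l + 1) / 2 ^ l)

lemma sum_chainStep_le {s : ℝ} (hs : 0 ≤ s) (k : ℕ) : ∑ m ∈ range k, chainStep s m ≤ 52 * s := by
  -- The full series of `(l + 1) / 2 ^ l` is `4`, whence `52 = 13 * 4`.
  have h : ∀ k : ℕ, ∑ m ∈ range k, chainStep s m = 13 * s * (4 - (2 * k + 4) / 2 ^ k) := by
    intro k
    induction k with
    | zero => simp
    | succ k ih =>
      rw [sum_range_succ, ih, chainStep]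
      push_cast
      field_simp
      ring
  rw [h]
  have : (0 : ℝ) ≤ (2 * k + 4) / 2 ^ k := by positivity
  nlinarith

/-- Dudley's bound at `ε = 4⁻ˡ` on `2n` points: `log (8 / ε)` is linear in `l`. -/
lemma log_card_le_of_scale {n V l : ℕ} (hn : 0 < n) (hV1 : 1 ≤ V)
    {𝒜 : Finset (Finset (Fin n × Bool))} (hne : 𝒜.Nonempty) (hV : 𝒜.vcDim ≤ V)
    (hsep : ∀ B ∈ 𝒜, ∀ B' ∈ 𝒜, B ≠ B' → 2 * n ≤ 4 ^ l * #(B ∆ B')) :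
    log #𝒜 ≤ 4 * V * (l + 1) := by
  have : Nonempty (Fin n × Bool) := ⟨⟨0, hn⟩, true⟩
  have h := log_card_le_of_separated hne hV (ε := 1 / 4 ^ l) (by positivity)
    (by rw [div_le_one (by positivity)]; exact one_le_pow₀ (by norm_num)) (by
      intro B hB B' hB' hBB'
      have h1 : ((2 * n : ℕ) : ℝ) ≤ ((4 ^ l * #(B ∆ B') : ℕ) : ℝ) := by
        exact_mod_cast hsep B hB B' hB' hBB'
      rw [Fintype.card_prod, Fintype.card_fin, Fintype.card_bool, one_div_mul_eq_div,
        div_le_iff₀ (by positivity)]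
      push_cast at h1 ⊢
      linarith)
  have h2 : log (8 / (1 / 4 ^ l)) = (3 + 2 * l) * log 2 := by
    rw [div_div_eq_mul_div, div_one, show (8 : ℝ) * 4 ^ l = 2 ^ (3 + 2 * l) by
      rw [pow_add, pow_mul]; norm_num, log_pow]
    push_cast; ring
  rw [h2] at h
  have h3 := log_two_lt_d9
  have hVr : (1 : ℝ) ≤ V := by exact_mod_cast hV1
  have hl : (0 : ℝ) ≤ l := by positivity
  have h4 : (3 + 2 * (l : ℝ)) * log 2 ≤ (3 + 2 * l) * 0.7 := by gcongr; linarith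
  have h5 : (V : ℝ) * ((3 + 2 * (l : ℝ)) * log 2) ≤ V * ((3 + 2 * l) * 0.7) := by gcongr
  nlinarith [mul_nonneg (by linarith : (0 : ℝ) ≤ V) hl]

/-- The tail bound for all links of the chain at one scale. -/
lemma card_link_tail_le {n V l : ℕ} (hn : 0 < n) (hV1 : 1 ≤ V) {τ : ℝ} (hτ : 0 ≤ τ)
    {𝒜 : Finset (Finset (Fin n × Bool))} (hne : 𝒜.Nonempty) (hV : 𝒜.vcDim ≤ V)
    (hsep : ∀ B ∈ 𝒜, ∀ B' ∈ 𝒜, B ≠ B' → 2 * n ≤ 4 ^ l * #(B ∆ B'))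
    (p : Finset (Fin n × Bool) → Finset (Fin n × Bool))
    (hp : ∀ B ∈ 𝒜, 4 ^ l * #(B ∆ p B) ≤ 8 * n) :
    (#{σ : Fin n → Bool | ∃ B ∈ 𝒜, chainStep √(n * (V + τ)) l <
      signedSum σ B - signedSum σ (p B)} : ℝ) ≤ 2 ^ n * exp (-τ) * (1 / 2) ^ (l + 1) := by
  classical
  have hnr : (0 : ℝ) < n := by exact_mod_cast hn
  have hVr : (1 : ℝ) ≤ V := by exact_mod_cast hV1
  have hl : (0 : ℝ) ≤ l := by positivity
  have h4 : (0 : ℝ) < 4 ^ l := by positivity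
  set u := chainStep √(n * (V + τ)) l with hu
  have hu0 : 0 ≤ u := by rw [hu, chainStep]; positivity
  set d : ℝ := 8 * n / 4 ^ l with hd
  have hsq : u ^ 2 / (4 * d) = 169 / 32 * ((l + 1) ^ 2 * (V + τ)) := by
    rw [hu, chainStep, hd, mul_pow, mul_pow, sq_sqrt (by positivity), div_pow, ← pow_mul,
      mul_comm l 2, pow_mul]
    norm_num
    field_simp
    ring
  have h1 : ∀ B ∈ 𝒜, (#{σ : Fin n → Bool | u < signedSum σ B - signedSum σ (p B)} : ℝ) ≤
      2 ^ n * exp (-(u ^ 2 / (4 * d))) := by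
    intro B hB
    refine card_signedSum_sub_le B (p B) (by positivity) hu0 ?_
    rw [hd, le_div_iff₀ h4]
    have : ((4 ^ l * #(B ∆ p B) : ℕ) : ℝ) ≤ ((8 * n : ℕ) : ℝ) := by exact_mod_cast hp B hB
    push_cast at this
    linarith
  have h2 : (#{σ : Fin n → Bool | ∃ B ∈ 𝒜, u < signedSum σ B - signedSum σ (p B)} : ℝ) ≤
      #𝒜 * (2 ^ n * exp (-(u ^ 2 / (4 * d)))) := by
    have : ({σ : Fin n → Bool | ∃ B ∈ 𝒜, u < signedSum σ B - signedSum σ (p B)} : Finset _) ⊆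
        𝒜.biUnion fun B ↦ {σ : Fin n → Bool | u < signedSum σ B - signedSum σ (p B)} := by
      intro σ hσ
      obtain ⟨B, hB, h⟩ := (mem_filter.1 hσ).2
      exact mem_biUnion.2 ⟨B, hB, by simpa using h⟩
    calc _ ≤ ((∑ B ∈ 𝒜, #{σ : Fin n → Bool | u < signedSum σ B - signedSum σ (p B)} : ℕ) : ℝ) := by
          exact_mod_cast (card_le_card this).trans card_biUnion_le
      _ ≤ ∑ B ∈ 𝒜, 2 ^ n * exp (-(u ^ 2 / (4 * d))) := by push_cast; exact sum_le_sum h1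
      _ = _ := by rw [sum_const, nsmul_eq_mul]
  have hM : (0 : ℝ) < #𝒜 := by exact_mod_cast hne.card_pos
  have h3 := log_card_le_of_scale hn hV1 hne hV hsep
  have h5 : ((1 : ℝ) / 2) ^ (l + 1) = exp (-((l + 1) * log 2)) := by
    rw [show -((l + 1) * log 2) = ((l + 1 : ℕ) : ℝ) * log (1 / 2) by
      rw [one_div, log_inv]; push_cast; ring, exp_nat_mul, exp_log (by norm_num)]
  refine h2.trans ?_
  rw [h5, hsq]
  have h6 := log_two_lt_d9
  have h7 : (l + 1) * log 2 ≤ (l + 1 : ℝ) := by nlinarith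
  have h8 : (l + 1) * ((V : ℝ) + τ) ≤ (l + 1) ^ 2 * (V + τ) := by
    gcongr; nlinarith
  -- Since `169 / 32 > 5`, the exponent pays `4V(l + 1)` for the cardinality, `V(l + 1)` for the
  -- factor `2^-(l + 1)`, and `τ`.
  have h9 : #𝒜 * exp (-(169 / 32 * ((l + 1) ^ 2 * (V + τ)))) ≤
      exp (-τ) * exp (-((l + 1) * log 2)) := by
    nth_rw 1 [← exp_log hM]
    rw [← exp_add, ← exp_add, exp_le_exp]
    nlinarith [mul_nonneg hl hτ, mul_nonneg hl (sub_nonneg.2 hVr)]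
  rw [mul_left_comm, mul_assoc]
  gcongr

/-- Each set is linked to a member of a maximal net one scale coarser, at distance at most `2n / 4^l
= 8n / 4^(l + 1)`. The failure fractions of the scales form a geometric series. -/
lemma card_chain_le {n V : ℕ} (hn : 0 < n) (hV1 : 1 ≤ V) {τ : ℝ} (hτ : 0 ≤ τ) (l : ℕ) :
    ∀ 𝒜 : Finset (Finset (Fin n × Bool)), 𝒜.Nonempty → 𝒜.vcDim ≤ V →
    (∀ B ∈ 𝒜, ∀ B' ∈ 𝒜, B ≠ B' → 2 * n ≤ 4 ^ l * #(B ∆ B')) →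
    (#{σ : Fin n → Bool | ∃ B ∈ 𝒜, ∑ m ∈ range (l + 1), chainStep √(n * (V + τ)) m <
      signedSum σ B} : ℝ) ≤ 2 ^ n * exp (-τ) * (1 - (1 / 2) ^ (l + 1)) := by
  classical
  induction l with
  | zero =>
    intro 𝒜 hne hV hsep
    -- The chain ends at the empty set, whose signed sum is zero.
    have h := card_link_tail_le hn hV1 hτ hne hV hsep (fun _ ↦ ∅) (by
      intro B _
      have := card_le_univ (B ∆ ∅)
      rw [Fintype.card_prod, Fintype.card_fin, Fintype.card_bool] at this
      omega)
    have h0 : ∀ σ : Fin n → Bool, signedSum σ ∅ = 0 := by simp [signedSum]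
    simp only [h0, sub_zero] at h
    simp only [zero_add, sum_range_one]
    refine h.trans (le_of_eq ?_)
    norm_num
  | succ l ih =>
    intro 𝒜 hne hV hsep
    obtain ⟨𝒢, h𝒢, h𝒢ne, h𝒢sep, hcov⟩ := exists_separated_net 𝒜 hne (2 * n) (4 ^ l)
    choose! p hp𝒢 hp using hcov
    have h1 := card_link_tail_le hn hV1 hτ hne hV hsep p (by
      intro B hB
      have := hp B hB
      rw [pow_succ]
      linarith)
    have h2 := ih 𝒢 h𝒢ne ((vcDim_mono h𝒢).trans hV) h𝒢sep
    refine (Nat.cast_le.2 ((card_le_card ?_).trans (card_union_le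
      {σ : Fin n → Bool | ∃ B ∈ 𝒜, chainStep √(n * (V + τ)) (l + 1) <
        signedSum σ B - signedSum σ (p B)}
      {σ : Fin n → Bool | ∃ B ∈ 𝒢, ∑ m ∈ range (l + 1), chainStep √(n * (V + τ)) m <
        signedSum σ B}))).trans ?_
    · intro σ hσ
      obtain ⟨B, hB, h⟩ := (mem_filter.1 hσ).2
      rw [sum_range_succ] at h
      simp only [mem_union, mem_filter, mem_univ, true_and]
      by_cases hc : chainStep √(n * (V + τ)) (l + 1) < signedSum σ B - signedSum σ (p B)
      · exact Or.inl ⟨B, hB, hc⟩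
      · exact Or.inr ⟨p B, hp𝒢 B hB, by linarith⟩
    · push_cast
      refine (add_le_add h1 h2).trans (le_of_eq ?_)
      rw [pow_succ _ (l + 1)]
      ring

/-- The symmetrized empirical process over a family of VC-dimension at most `V` is of order
`√(n (V + τ))`, outside of a fraction `exp (-τ)` of the sign patterns. -/
theorem card_exists_signedSum_gt_le {n V : ℕ} (hn : 0 < n) (hV1 : 1 ≤ V) {τ : ℝ} (hτ : 0 ≤ τ)
    (𝒜 : Finset (Finset (Fin n × Bool))) (hV : 𝒜.vcDim ≤ V) :
    (#{σ : Fin n → Bool | ∃ B ∈ 𝒜, 52 * √(n * (V + τ)) < signedSum σ B} : ℝ) ≤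
      2 ^ n * exp (-τ) := by
  classical
  rcases 𝒜.eq_empty_or_nonempty with rfl | hne
  · simp; positivity
  -- At scale `2 * n` separation only asks that distinct sets differ, so the whole family is its own
  -- net.
  have h := card_chain_le hn hV1 hτ (2 * n) 𝒜 hne hV (by
    intro B _ B' _ hBB'
    have h1 : 0 < #(B ∆ B') := card_pos.2 (nonempty_iff_ne_empty.2 (by simpa using hBB'))
    have h2 : 2 * n < 4 ^ (2 * n) := Nat.lt_pow_self (by norm_num)
    nlinarith)
  have hle := sum_chainStep_le (sqrt_nonneg (n * (V + τ))) (2 * n + 1)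
  calc _ ≤ (#{σ : Fin n → Bool | ∃ B ∈ 𝒜, ∑ m ∈ range (2 * n + 1), chainStep √(n * (V + τ)) m <
      signedSum σ B} : ℝ) := by
        refine Nat.cast_le.2 (card_le_card fun σ hσ ↦ ?_)
        obtain ⟨B, hB, h⟩ := (mem_filter.1 hσ).2
        exact mem_filter.2 ⟨mem_univ _, B, hB, hle.trans_lt h⟩
    _ ≤ _ := h
    _ ≤ _ := mul_le_of_le_one_right (by positivity) (by simp)

/-! ### Hoeffding's inequality and symmetrization -/

open ProbabilityTheory

/-- The one-sided **Hoeffding inequality** for the frequency of an event in an i.i.d. sample. -/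
lemma measure_frequency_deviation_le {Z : Type*} [MeasurableSpace Z] (D : Measure Z)
    [IsProbabilityMeasure D] {n : ℕ} (hn : 0 < n) {E : Set Z} (hE : MeasurableSet E) {s : ℝ}
    (hs : 0 ≤ s) :
    (Measure.pi fun _ : Fin n ↦ D)
      {S | n * s ≤ n * D.real E - ∑ j, E.indicator (1 : Z → ℝ) (S j)} ≤
        ENNReal.ofReal (exp (-(2 * n * s ^ 2))) := by
  have hnr : (0 : ℝ) < n := by exact_mod_cast hn
  set g : Z → ℝ := fun z ↦ - E.indicator (1 : Z → ℝ) z with hg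
  have hgm : Measurable g := (measurable_one.indicator hE).neg
  have hint : ∫ z, g z ∂D = - D.real E := by
    rw [hg, integral_neg, integral_indicator_one hE]
  have hsub : HasSubgaussianMGF (fun z ↦ g z + D.real E) ((‖(0 : ℝ) - (-1)‖₊ / 2) ^ 2) D := by
    have := hasSubgaussianMGF_of_mem_Icc (μ := D) (X := g) (a := -1) (b := 0) hgm.aemeasurable
      (ae_of_all _ fun z ↦ by by_cases h : z ∈ E <;> simp [hg, h])
    simpa [hint] using this
  have hind : iIndepFun (fun (i : Fin n) (S : Fin n → Z) ↦ g (S i) + D.real E)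
      (Measure.pi fun _ ↦ D) :=
    iIndepFun_pi (X := fun _ z ↦ g z + D.real E) fun i ↦ (hgm.add_const _).aemeasurable
  have hsub' : ∀ i ∈ (univ : Finset (Fin n)), HasSubgaussianMGF
      (fun S : Fin n → Z ↦ g (S i) + D.real E) ((‖(0 : ℝ) - (-1)‖₊ / 2) ^ 2)
      (Measure.pi fun _ ↦ D) := by
    intro i _
    have hmp := measurePreserving_eval (fun _ : Fin n ↦ D) i
    refine HasSubgaussianMGF.of_map (Y := Function.eval i) (X := fun z ↦ g z + D.real E) hmp.measurable.aemeasurable ?_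
    rw [hmp.map_eq]
    exact hsub
  have h := HasSubgaussianMGF.measure_sum_ge_le_of_iIndepFun hind hsub'
    (ε := n * s) (by positivity)
  have hset : {S : Fin n → Z | n * s ≤ n * D.real E - ∑ j, E.indicator (1 : Z → ℝ) (S j)} =
      {S | n * s ≤ ∑ i, (g (S i) + D.real E)} := by
    ext S
    simp only [Set.mem_ofPred_eq, sum_add_distrib, hg, sum_neg_distrib, sum_const, card_univ,
      Fintype.card_fin, nsmul_eq_mul]
    rw [neg_add_eq_sub]
  rw [hset, ← ofReal_measureReal (measure_ne_top _ _)]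
  refine ENNReal.ofReal_le_ofReal (h.trans (le_of_eq ?_))
  congr 1
  simp only [sum_const, card_univ, Fintype.card_fin, nsmul_eq_mul]
  push_cast
  norm_num
  field_simp
  norm_num

/-- Exchange the two members of the pairs at which the sign is negative. -/
def swapPairs {Z : Type*} {n : ℕ} (σ : Fin n → Bool) (w : Fin n → Z × Z) : Fin n → Z × Z :=
  fun j ↦ if σ j then w j else (w j).swap

lemma measurePreserving_swapPairs {Z : Type*} [MeasurableSpace Z] (D : Measure Z)
    [IsProbabilityMeasure D] {n : ℕ} (σ : Fin n → Bool) :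
    MeasurePreserving (swapPairs σ) (Measure.pi fun _ : Fin n ↦ D.prod D)
      (Measure.pi fun _ : Fin n ↦ D.prod D) := by
  refine measurePreserving_pi (f := fun j (z : Z × Z) ↦ if σ j then z else z.swap) _ _ fun j ↦ ?_
  by_cases h : σ j
  · simp only [h, if_true]; exact MeasurePreserving.id (D.prod D)
  · simpa [h] using Measure.measurePreserving_swap (μ := D) (ν := D)

/-- An event about a sample of pairs is at most as likely as its largest conditional probability
given the sample up to exchanges within the pairs. -/
lemma measure_le_of_card_swapPairs_le {Z R : Type*} [MeasurableSpace Z] [MeasurableSpace R]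
    (D : Measure Z) [IsProbabilityMeasure D] (ρ : Measure R) [IsProbabilityMeasure ρ] {n : ℕ}
    {E : Set (R × (Fin n → Z × Z))} (hE : MeasurableSet E) {q : ℝ}
    (h : ∀ r w, (Nat.card {σ : Fin n → Bool // (r, swapPairs σ w) ∈ E} : ℝ) ≤ 2 ^ n * q) :
    (ρ.prod (Measure.pi fun _ : Fin n ↦ D.prod D)) E ≤ ENNReal.ofReal q := by
  classical
  set μ := ρ.prod (Measure.pi fun _ : Fin n ↦ D.prod D)
  have hmp : ∀ σ : Fin n → Bool, MeasurePreserving (Prod.map id (swapPairs σ)) μ μ := fun σ ↦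
    (MeasurePreserving.id ρ).prod (measurePreserving_swapPairs D σ)
  have hm : ∀ σ : Fin n → Bool,
      MeasurableSet (Prod.map (id : R → R) (swapPairs (Z := Z) σ) ⁻¹' E) :=
    fun σ ↦ (hmp σ).measurable hE
  have h1 : (2 ^ n : ENNReal) * μ E ≤ 2 ^ n * ENNReal.ofReal q := by
    calc (2 ^ n : ENNReal) * μ E
        = ∑ σ : Fin n → Bool, μ (Prod.map (id : R → R) (swapPairs (Z := Z) σ) ⁻¹' E) := by
          rw [sum_congr rfl fun σ _ ↦ (hmp σ).measure_preimage hE.nullMeasurableSet]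
          simp
      _ = ∑ σ : Fin n → Bool, ∫⁻ p, (Prod.map (id : R → R) (swapPairs (Z := Z) σ) ⁻¹' E).indicator
          1 p ∂μ := by
          refine sum_congr rfl fun σ _ ↦ ?_
          rw [lintegral_indicator_one (hm σ)]
      _ = ∫⁻ p, ∑ σ : Fin n → Bool, (Prod.map (id : R → R) (swapPairs (Z := Z) σ) ⁻¹' E).indicator
          1 p ∂μ := by
          rw [lintegral_finsetSum _ fun σ _ ↦ measurable_one.indicator (hm σ)]
      _ ≤ ∫⁻ _, 2 ^ n * ENNReal.ofReal q ∂μ := by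
          refine lintegral_mono fun p ↦ ?_
          have hp := h p.1 p.2
          rw [Nat.card_eq_fintype_card, Fintype.card_subtype] at hp
          have : ∑ σ : Fin n → Bool, (Prod.map (id : R → R) (swapPairs (Z := Z) σ) ⁻¹' E).indicator
              (1 : R × (Fin n → Z × Z) → ENNReal) p =
              ((#{σ : Fin n → Bool | (p.1, swapPairs σ p.2) ∈ E} : ℕ) : ENNReal) := by
            simp only [Set.indicator_apply, Set.mem_preimage, Prod.map, id, Pi.one_apply, sum_boole]
          simp only [this]
          rw [← ENNReal.ofReal_natCast]
          refine (ENNReal.ofReal_le_ofReal hp).trans (le_of_eq ?_)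
          rw [ENNReal.ofReal_mul (by positivity), ENNReal.ofReal_pow (by norm_num)]
          norm_num
      _ = _ := by simp
  exact (ENNReal.mul_le_mul_iff_right (by simp) (by simp)).1 h1

lemma measurePreserving_splitPairs {Z R : Type*} [MeasurableSpace Z] [MeasurableSpace R]
    (D : Measure Z) [IsProbabilityMeasure D] (ρ : Measure R) [IsProbabilityMeasure ρ] {n : ℕ} :
    MeasurePreserving (fun p : R × (Fin n → Z × Z) ↦
        ((p.1, fun j ↦ (p.2 j).1), fun j ↦ (p.2 j).2))
      (ρ.prod (Measure.pi fun _ : Fin n ↦ D.prod D))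
      ((ρ.prod (Measure.pi fun _ : Fin n ↦ D)).prod (Measure.pi fun _ : Fin n ↦ D)) := by
  have h1 := (MeasurePreserving.id ρ).prod
    (measurePreserving_arrowProdEquivProdArrow Z Z (Fin n) (fun _ ↦ D) (fun _ ↦ D))
  have h2 := (measurePreserving_prodAssoc ρ (Measure.pi fun _ : Fin n ↦ D)
    (Measure.pi fun _ : Fin n ↦ D)).symm
  exact h2.comp h1

section Symmetrization

variable {Z R : Type*} [MeasurableSpace Z] [MeasurableSpace R] {n : ℕ}

/-- The number of sample points in a set. -/
noncomputable def hits (S : Fin n → Z) (E : Set Z) : ℝ := ∑ j, E.indicator (1 : Z → ℝ) (S j)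

lemma measurable_hits {Ω : Type*} [MeasurableSpace Ω] {B : R → (Fin n → Z) → Set Z}
    (hB : MeasurableSet {p : (R × (Fin n → Z)) × Z | p.2 ∈ B p.1.1 p.1.2})
    {f : Ω → R × (Fin n → Z)} (hf : Measurable f) {g : Ω → Fin n → Z} (hg : Measurable g) :
    Measurable fun ω ↦ hits (g ω) (B (f ω).1 (f ω).2) := by
  refine Finset.measurable_sum _ fun j _ ↦ ?_
  have h1 : Measurable fun ω ↦ (f ω, g ω j) := hf.prodMk ((measurable_pi_apply j).comp hg)
  exact ((measurable_one (β := (R × (Fin n → Z)) × Z) (α := ℝ)).indicator hB).comp h1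

/-- **Symmetrization by a ghost sample** for the output of a randomized learning algorithm. -/
lemma measure_deviation_le_two_mul (D : Measure Z) [IsProbabilityMeasure D] (ρ : Measure R)
    [IsProbabilityMeasure ρ] (hn : 0 < n) {B : R → (Fin n → Z) → Set Z}
    (hB : MeasurableSet {p : (R × (Fin n → Z)) × Z | p.2 ∈ B p.1.1 p.1.2}) {t : ℝ} (ht : 0 ≤ t)
    (hnt : 2 ≤ n * t ^ 2) :
    (ρ.prod (Measure.pi fun _ : Fin n ↦ D))
        {ω | n * t < n * D.real (B ω.1 ω.2) - hits ω.2 (B ω.1 ω.2)} ≤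
      2 * (ρ.prod (Measure.pi fun _ : Fin n ↦ D.prod D))
        {p | n * t / 2 < hits (fun j ↦ (p.2 j).2) (B p.1 fun j ↦ (p.2 j).1) -
          hits (fun j ↦ (p.2 j).1) (B p.1 fun j ↦ (p.2 j).1)} := by
  set P := Measure.pi fun _ : Fin n ↦ D
  set G : Set ((R × (Fin n → Z)) × (Fin n → Z)) :=
    {q | n * t / 2 < hits q.2 (B q.1.1 q.1.2) - hits q.1.2 (B q.1.1 q.1.2)} with hG
  have hGm : MeasurableSet G := measurableSet_lt measurable_const
    ((measurable_hits hB measurable_fst measurable_snd).sub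
      (measurable_hits hB measurable_fst (measurable_snd.comp measurable_fst)))
  have hmp := (measurePreserving_splitPairs D ρ (n := n)).measure_preimage hGm.nullMeasurableSet
  have hpre : (fun p : R × (Fin n → Z × Z) ↦
        ((p.1, fun j ↦ (p.2 j).1), fun j ↦ (p.2 j).2)) ⁻¹' G =
      {p | n * t / 2 < hits (fun j ↦ (p.2 j).2) (B p.1 fun j ↦ (p.2 j).1) -
          hits (fun j ↦ (p.2 j).1) (B p.1 fun j ↦ (p.2 j).1)} := rfl
  rw [← hpre, hmp, Measure.prod_apply hGm]
  set bad : Set (R × (Fin n → Z)) :=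
    {ω | n * t < n * D.real (B ω.1 ω.2) - hits ω.2 (B ω.1 ω.2)} with hbad
  have hbadm : MeasurableSet bad := by
    refine measurableSet_lt measurable_const (Measurable.sub (Measurable.const_mul ?_ _)
      (measurable_hits hB measurable_id measurable_snd))
    exact (measurable_measure_prodMk_left hB).ennreal_toReal
  have hhalf : ∀ ω ∈ bad, (1 / 2 : ENNReal) ≤ P (Prod.mk ω ⁻¹' G) := by
    intro ω hω
    have hEm : MeasurableSet (B ω.1 ω.2) := measurable_prodMk_left (x := ω) hB
    have hH := measure_frequency_deviation_le D hn hEm (s := t / 2) (by positivity)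
    -- By `hnt` the exponent is at most `-1`, so the ghost frequency is accurate to `t / 2` with
    -- probability at least `1 / 2`.
    have hsmall : exp (-(2 * n * (t / 2) ^ 2)) ≤ 1 / 2 := by
      have h1 : exp (-(2 * n * (t / 2) ^ 2)) ≤ exp (-1) := by gcongr; nlinarith
      have h2 := exp_neg_one_lt_d9
      linarith
    have hcov : (Set.univ : Set (Fin n → Z)) ⊆ Prod.mk ω ⁻¹' G ∪
        {S | n * (t / 2) ≤ n * D.real (B ω.1 ω.2) -
          ∑ j, (B ω.1 ω.2).indicator (1 : Z → ℝ) (S j)} := by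
      intro S _
      by_cases hS : n * (t / 2) ≤ n * D.real (B ω.1 ω.2) -
          ∑ j, (B ω.1 ω.2).indicator (1 : Z → ℝ) (S j)
      · exact Or.inr hS
      · left
        simp only [hbad, Set.mem_ofPred_eq] at hω
        simp only [hG, Set.mem_preimage, Set.mem_ofPred_eq]
        have : hits S (B ω.1 ω.2) = ∑ j, (B ω.1 ω.2).indicator (1 : Z → ℝ) (S j) := rfl
        rw [← this] at hS
        linarith
    have h1 : (1 : ENNReal) ≤ P (Prod.mk ω ⁻¹' G) + 1 / 2 := by
      calc (1 : ENNReal) = P Set.univ := measure_univ.symm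
        _ ≤ _ := (measure_mono hcov).trans (measure_union_le _ _)
        _ ≤ P (Prod.mk ω ⁻¹' G) + ENNReal.ofReal (1 / 2) := by
          gcongr; exact hH.trans (ENNReal.ofReal_le_ofReal hsmall)
        _ = _ := by
          rw [ENNReal.ofReal_div_of_pos (by norm_num)]; norm_num
    have h2 : (1 / 2 : ENNReal) + 1 / 2 ≤ P (Prod.mk ω ⁻¹' G) + 1 / 2 := by
      rwa [ENNReal.add_halves]
    exact (ENNReal.add_le_add_iff_right (by simp)).1 h2
  have h3 : (1 / 2 : ENNReal) * (ρ.prod P) bad ≤ ∫⁻ ω, P (Prod.mk ω ⁻¹' G) ∂(ρ.prod P) := by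
    rw [← setLIntegral_const]
    exact (setLIntegral_mono_ae' hbadm (ae_of_all _ hhalf)).trans (setLIntegral_le_lintegral _ _)
  calc (ρ.prod P) bad = 2 * (1 / 2 * (ρ.prod P) bad) := by
        rw [← mul_assoc, one_div, ENNReal.mul_inv_cancel (by simp) (by simp), one_mul]
    _ ≤ _ := by gcongr

end Symmetrization

/-! ### The bound for one class -/

section OneClass

variable {X R : Type*} {k n : ℕ}

lemma sampleErr_eq_hits_div (S : Fin n → X × Fin k) (i : Fin k) (h : Set X) :
    sampleErr S i h = hits S (errorSet i h) / n := by
  classical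
  rw [sampleErr, hits, Set.ncard_eq_toFinset_card']
  simp [Set.indicator_apply]

lemma Shatters.card_le {H : Set (Set X)} {V : ℕ} (hV : vcDim H = V) {s : Finset X}
    (hs : Shatters H s) : #s ≤ V := by
  have : (#s : ℕ∞) ≤ vcDim H := le_iSup₂_of_le (f := fun (s : Finset X) (_ : Shatters H s) ↦
    (#s : ℕ∞)) s hs le_rfl
  rw [hV] at this
  exact_mod_cast this

lemma subsingleton_of_vcDim_eq_zero {H : Set (Set X)} (hV : vcDim H = (0 : ℕ)) :
    H.Subsingleton := by
  classical
  intro h hh h' hh'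
  by_contra hne
  have : ∃ x, ¬ (x ∈ h ↔ x ∈ h') := by
    by_contra! hcon
    exact hne (Set.ext hcon)
  obtain ⟨x, hx⟩ := this
  wlog hxh : x ∈ h generalizing h h'
  · exact this hh' hh (Ne.symm hne) (by tauto) (by tauto)
  have hxh' : x ∉ h' := by tauto
  have hs : Shatters H {x} := by
    intro t ht
    rcases Finset.subset_singleton_iff.1 ht with rfl | rfl
    · exact ⟨h', hh', by simpa using hxh'⟩
    · exact ⟨h, hh, by simpa using hxh⟩
  simpa using hs.card_le hV

/-- The hits of `E` in the two halves of a pair sample after exchanges, as a signed sum. -/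
lemma hits_swapPairs_sub {Z : Type*} (σ : Fin n → Bool) (w : Fin n → Z × Z) (E : Set Z)
    (B : Finset (Fin n × Bool))
    (hB : ∀ p, p ∈ B ↔ (if p.2 then (w p.1).2 else (w p.1).1) ∈ E) :
    hits (fun j ↦ (swapPairs σ w j).2) E - hits (fun j ↦ (swapPairs σ w j).1) E =
      signedSum σ B := by
  classical
  simp only [hits, signedSum, ← sum_sub_distrib]
  refine sum_congr rfl fun j _ ↦ ?_
  simp only [hB, boolSign, swapPairs, Set.indicator_apply]
  by_cases h : σ j <;> simp [h]

/-- For fixed double samples, few exchanges give a large deviation for some concept of `H`. -/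
lemma card_swapPairs_deviation_le {V : ℕ} (hn : 0 < n) (hV1 : 1 ≤ V) {H : Set (Set X)}
    (hV : vcDim H = V) (i : Fin k) {τ : ℝ} (hτ : 0 ≤ τ) (w : Fin n → (X × Fin k) × (X × Fin k))
    {P : (Fin n → Bool) → Prop}
    (hP : ∀ σ, P σ → ∃ h ∈ H, 52 * √(n * (V + τ)) <
      hits (fun j ↦ (swapPairs σ w j).2) (errorSet i h) -
        hits (fun j ↦ (swapPairs σ w j).1) (errorSet i h)) :
    (Nat.card {σ // P σ} : ℝ) ≤ 2 ^ n * exp (-τ) := by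
  classical
  let z : Fin n × Bool → X × Fin k := fun p ↦ if p.2 then (w p.1).2 else (w p.1).1
  let trace : Set X → Finset (Fin n × Bool) := fun h ↦ {p | z p ∈ errorSet i h}
  let 𝒜 : Finset (Finset (Fin n × Bool)) := {B | ∃ h ∈ H, B = trace h}
  have h𝒜 : 𝒜.vcDim ≤ V := by
    refine Finset.sup_le fun s hs ↦ ?_
    rw [mem_shatterer] at hs
    obtain ⟨s', hs', hcard⟩ := exists_shatters_of_trace (H := H) (fun p ↦ (z p).1)
      (fun p ↦ (z p).2 = i) (by
        intro B hB
        obtain ⟨h, hh, rfl⟩ := (mem_filter.1 hB).2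
        exact ⟨h, hh, fun p ↦ mem_filter.trans (and_iff_right (mem_univ p))⟩) hs
    rw [← hcard]
    exact hs'.card_le hV
  refine le_trans ?_ (card_exists_signedSum_gt_le hn hV1 hτ 𝒜 h𝒜)
  rw [Nat.card_eq_fintype_card, Fintype.card_subtype]
  refine Nat.cast_le.2 (card_le_card fun σ hσ ↦ ?_)
  obtain ⟨h, hh, hlt⟩ := hP σ (mem_filter.1 hσ).2
  refine mem_filter.2 ⟨mem_univ _, trace h, mem_filter.2 ⟨mem_univ _, h, hh, rfl⟩, ?_⟩
  rwa [← hits_swapPairs_sub σ w (errorSet i h) (trace h) fun p ↦ by simp [trace, z]]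

variable [MeasurableSpace X] [MeasurableSpace R]

/-- The generalization bound for the classifier of one class. -/
theorem measure_err_sub_sampleErr_gt_le {V : ℕ} (hn : 0 < n) {H : Set (Set X)}
    (hV : vcDim H = V) (D : Measure (X × Fin k)) [IsProbabilityMeasure D] (ρ : Measure R)
    [IsProbabilityMeasure ρ] (i : Fin k) {A : R → (Fin n → X × Fin k) → Set X}
    (hAH : ∀ r S, A r S ∈ H)
    (hA : MeasurableSet {p : (R × (Fin n → X × Fin k)) × X | p.2 ∈ A p.1.1 p.1.2})
    {ℓ : ℝ} (hℓ : 0 ≤ ℓ) :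
    (ρ.prod (Measure.pi fun _ : Fin n ↦ D))
      {ω | 150 * √((V + ℓ) / n) < err D i (A ω.1 ω.2) - sampleErr ω.2 i (A ω.1 ω.2)} ≤
        ENNReal.ofReal (exp (-ℓ)) := by
  have hnr : (0 : ℝ) < n := by exact_mod_cast hn
  set t := 150 * √((V + ℓ) / n) with ht
  have ht0 : 0 ≤ t := by positivity
  have htsq : n * t ^ 2 = 22500 * (V + ℓ) := by
    rw [ht, mul_pow, sq_sqrt (by positivity)]
    field_simp
    ring
  have hB : MeasurableSet {p : (R × (Fin n → X × Fin k)) × (X × Fin k) |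
      p.2 ∈ errorSet i (A p.1.1 p.1.2)} := by
    have h1 : MeasurableSet {p : (R × (Fin n → X × Fin k)) × (X × Fin k) |
        p.2.1 ∈ A p.1.1 p.1.2} :=
      (measurable_fst.prodMk (measurable_fst.comp measurable_snd)) hA
    have h2 : MeasurableSet {p : (R × (Fin n → X × Fin k)) × (X × Fin k) | p.2.2 = i} :=
      (measurable_snd.comp measurable_snd) (measurableSet_singleton i)
    exact (h1.iff h2).compl
  have hbad : {ω : R × (Fin n → X × Fin k) |
      t < err D i (A ω.1 ω.2) - sampleErr ω.2 i (A ω.1 ω.2)} =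
      {ω | n * t < n * D.real (errorSet i (A ω.1 ω.2)) -
        hits ω.2 (errorSet i (A ω.1 ω.2))} := by
    ext ω
    simp only [Set.mem_ofPred_eq, sampleErr_eq_hits_div, err]
    rw [← mul_lt_mul_iff_right₀ hnr, mul_sub, mul_div_cancel₀ _ hnr.ne']
  rw [hbad]
  -- Chaining needs `1 ≤ V`. For `V = 0` only one concept can occur, and Hoeffding alone suffices.
  rcases Nat.eq_zero_or_pos V with rfl | hV1
  · have hsub := subsingleton_of_vcDim_eq_zero hV
    obtain ⟨ω₀⟩ : Nonempty (R × (Fin n → X × Fin k)) :=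
      nonempty_of_isProbabilityMeasure (ρ.prod (Measure.pi fun _ : Fin n ↦ D))
    set E := errorSet i (A ω₀.1 ω₀.2)
    have hE : MeasurableSet E := measurable_prodMk_left (x := ω₀) hB
    have hconst : ∀ ω : R × (Fin n → X × Fin k), errorSet i (A ω.1 ω.2) = E := fun ω ↦ by
      rw [hsub (hAH ω.1 ω.2) (hAH ω₀.1 ω₀.2)]
    simp only [hconst]
    calc (ρ.prod (Measure.pi fun _ : Fin n ↦ D)) {ω | n * t < n * D.real E - hits ω.2 E}
        ≤ (ρ.prod (Measure.pi fun _ : Fin n ↦ D)) (Set.univ ×ˢ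
          {S | n * t ≤ n * D.real E - ∑ j, E.indicator (1 : X × Fin k → ℝ) (S j)}) :=
          measure_mono fun ω hω ↦ by
            simp only [Set.mem_ofPred_eq, hits] at hω
            simpa using hω.le
      _ ≤ ENNReal.ofReal (exp (-(2 * n * t ^ 2))) := by
          rw [Measure.prod_prod, measure_univ, one_mul]
          exact measure_frequency_deviation_le D hn hE ht0
      _ ≤ _ := by
          refine ENNReal.ofReal_le_ofReal (exp_le_exp.2 ?_)
          rw [mul_assoc, htsq]
          push_cast
          linarith
  have hVr : (1 : ℝ) ≤ V := by exact_mod_cast hV1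
  have hlog2 := log_two_lt_d9
  have hlog2' : 0 ≤ log 2 := (log_pos one_lt_two).le
  -- The added `log 2` in `τ` cancels the factor `2` of symmetrization. It is below `V`, and `22500
  -- / 10816 > 2` leaves room for it.
  have hthr : 52 * √(n * (V + (ℓ + log 2))) ≤ n * t / 2 := by
    have h1 : √(n * (V + (ℓ + log 2))) ≤ n * t / 104 := by
      refine sqrt_le_iff.2 ⟨by positivity, ?_⟩
      have h2 : (n * t / 104) ^ 2 = n * (n * t ^ 2) / 10816 := by ring
      rw [h2, htsq, mul_div_assoc]
      gcongr
      linarith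
    linarith
  refine (measure_deviation_le_two_mul D ρ hn (B := fun r S ↦ errorSet i (A r S)) hB ht0 (by rw [htsq]; linarith)).trans ?_
  have hEm : MeasurableSet {p : R × (Fin n → (X × Fin k) × (X × Fin k)) | n * t / 2 <
      hits (fun j ↦ (p.2 j).2) (errorSet i (A p.1 fun j ↦ (p.2 j).1)) -
        hits (fun j ↦ (p.2 j).1) (errorSet i (A p.1 fun j ↦ (p.2 j).1))} := by
    have hf : Measurable fun p : R × (Fin n → (X × Fin k) × (X × Fin k)) ↦
        (p.1, fun j ↦ (p.2 j).1) := by fun_prop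
    have hg : Measurable fun p : R × (Fin n → (X × Fin k) × (X × Fin k)) ↦
        fun j ↦ (p.2 j).2 := by fun_prop
    exact measurableSet_lt measurable_const ((measurable_hits (B := fun r S ↦ errorSet i (A r S)) hB hf hg).sub
      (measurable_hits (B := fun r S ↦ errorSet i (A r S)) hB hf (measurable_snd.comp hf)))
  have hmain := measure_le_of_card_swapPairs_le D ρ hEm (q := exp (-(ℓ + log 2))) (by
    intro r w
    refine card_swapPairs_deviation_le hn hV1 hV i (by positivity) w fun σ hσ ↦ ?_
    -- The output varies with `σ` through its training half; only its membership in `H` is used.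
    exact ⟨_, hAH r fun j ↦ (swapPairs σ w j).1, hthr.trans_lt hσ⟩)
  calc _ ≤ 2 * ENNReal.ofReal (exp (-(ℓ + log 2))) := by gcongr
    _ = ENNReal.ofReal (2 * exp (-(ℓ + log 2))) := by
        rw [ENNReal.ofReal_mul (by norm_num)]; norm_num
    _ = _ := by
        rw [neg_add, exp_add, exp_neg (log 2), exp_log (by norm_num)]
        congr 1; ring

end OneClass

end OneVsAll

/-! ### Union bound over the classes -/

/-- `A i r S` is the classifier trained for class `i` on the sample `S`, where `r` is the internal
randomness of the training (a one-point `R` gives deterministic training). -/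
theorem mainTheorem5 :
    ∃ c : ℝ, 0 < c ∧
      ∀ {X : Type*} [MeasurableSpace X] {R : Type*} [MeasurableSpace R]
        (k n V : ℕ) (_ : 1 ≤ n)
        (H : Set (Set X)) (_ : OneVsAll.vcDim H = (V : ℕ∞))
        (D : Measure (X × Fin k)) [IsProbabilityMeasure D]
        (ρ : Measure R) [IsProbabilityMeasure ρ]
        (A : Fin k → R → (Fin n → X × Fin k) → Set X)
        (_ : ∀ i r S, A i r S ∈ H)
        (_ : ∀ i, MeasurableSet
          {p : (R × (Fin n → X × Fin k)) × X | p.2 ∈ A i p.1.1 p.1.2})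
        (δ : ℝ) (_ : 0 < δ) (_ : δ < 1),
        ENNReal.ofReal (1 - δ) ≤
          (ρ.prod (Measure.pi fun _ : Fin n => D))
            {ω | ∀ i : Fin k,
              OneVsAll.err D i (A i ω.1 ω.2) - OneVsAll.sampleErr ω.2 i (A i ω.1 ω.2) ≤
                c * Real.sqrt (((V : ℝ) + Real.log ((k : ℝ) / δ)) / (n : ℝ))} := by
  refine ⟨150, by norm_num, ?_⟩
  intro X _ R _ k n V hn H hV D _ ρ _ A hAH hA δ hδ0 hδ1
  -- A probability measure lives on a nonempty space, so a label exists.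
  have hk : (1 : ℝ) ≤ k := by
    obtain ⟨z⟩ := nonempty_of_isProbabilityMeasure D
    exact_mod_cast z.2.pos
  have hkδ : 1 ≤ (k : ℝ) / δ := by rw [one_le_div hδ0]; linarith
  set μ := ρ.prod (Measure.pi fun _ : Fin n => D)
  set good := {ω : R × (Fin n → X × Fin k) | ∀ i : Fin k,
    OneVsAll.err D i (A i ω.1 ω.2) - OneVsAll.sampleErr ω.2 i (A i ω.1 ω.2) ≤
      150 * Real.sqrt (((V : ℝ) + Real.log ((k : ℝ) / δ)) / (n : ℝ))} with hgood
  have hbad : μ goodᶜ ≤ ENNReal.ofReal δ := by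
    calc μ goodᶜ ≤ μ (⋃ i : Fin k, {ω | 150 * Real.sqrt ((V + Real.log (k / δ)) / n) <
          OneVsAll.err D i (A i ω.1 ω.2) - OneVsAll.sampleErr ω.2 i (A i ω.1 ω.2)}) := by
          refine measure_mono fun ω hω ↦ ?_
          simp only [hgood, Set.mem_compl_iff, Set.mem_ofPred_eq, not_forall, not_le] at hω
          exact Set.mem_iUnion.2 hω
      _ ≤ ∑ i : Fin k, μ {ω | 150 * Real.sqrt ((V + Real.log (k / δ)) / n) <
          OneVsAll.err D i (A i ω.1 ω.2) - OneVsAll.sampleErr ω.2 i (A i ω.1 ω.2)} :=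
          measure_iUnion_fintype_le _ _
      _ ≤ ∑ _i : Fin k, ENNReal.ofReal (Real.exp (-Real.log (k / δ))) :=
          Finset.sum_le_sum fun i _ ↦ OneVsAll.measure_err_sub_sampleErr_gt_le hn hV D ρ i
            (hAH i) (hA i) (Real.log_nonneg hkδ)
      _ = ENNReal.ofReal δ := by
          rw [Finset.sum_const, Finset.card_univ, Fintype.card_fin, nsmul_eq_mul,
            ← ENNReal.ofReal_natCast, ← ENNReal.ofReal_mul (by positivity), Real.exp_neg,
            Real.exp_log (by positivity), inv_div, mul_div_cancel₀ _ (by positivity)]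
  have h1 : 1 ≤ μ good + ENNReal.ofReal δ := by
    calc (1 : ENNReal) = μ (good ∪ goodᶜ) := by rw [Set.union_compl_self, measure_univ]
      _ ≤ μ good + μ goodᶜ := measure_union_le _ _
      _ ≤ _ := by gcongr
  rw [ENNReal.ofReal_sub _ hδ0.le, ENNReal.ofReal_one]
  exact tsub_le_iff_right.2 h1
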